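/- **TSO model.** There are $n$ processes, a finite set $\mathsf{Var}$ of variables, a main memory $\mathsf m:\mathsf{Var}\to\mathsf{Val}$ and, for each process $i$, a FIFO store buffer of pairs $(x,v)$. A write by $i$ appends a pair to $i$'s buffer; a read of $x$ by $i$ returns the latest value for $x$ in $i$'s buffer, or $\mathsf m(x)$ if there is none; a fence $\mathtt F$ of $i$ is enabled only when $i$'s buffer is empty; $\mathtt{RMW}(x,v_{\rm exp},v_{\rm new})$ is enabled only when $i$'s buffer is empty and $\mathsf m(x)=v_{\rm exp}$, and it sets $\mathsf m(x)$ to $v_{\rm new}$; a local dispatcher $d_i$ may at any time move the oldest pair of $i$'s nonempty buffer to memory ($\mathtt{prop}$). There are also internal actions, and actions $\mathtt{return}$ that end an operation. Local states are the complete local histories of actions, returned values and invocations. A run is an infinite sequence of global states that starts with empty buffers and local states; each round performs a joint action of processes, dispatchers and environment whose actions are enabled and pairwise non-conflicting (no two memory accesses to one variable, unless both are reads from memory). **Register implementations.** A register implementation $\mathcal I$ consists of an initial memory and a nondeterministic protocol, which assigns to every process and local state a nonempty set of allowed (possibly null) actions. The register has values in an infinite set $V$ and a default value $v_0\in V$.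 In a run of $\mathcal I$ every non-null action is allowed by the protocol, the environment invokes $\mathsf{Read}$ and $\mathsf{Write}(v)$ operations ($v\in V$) only at processes that have no pending operation, and each value is written by at most one $\mathsf{Write}$ operation. $\mathcal I$ is *linearizable* if the history of operations of every finite prefix of every run is linearizable with respect to the sequential register with default value $v_0$. $\mathcal I$ is *obstruction-free* if a pending operation of a process $i$ completes whenever from some time on no process other than $i$ takes steps (while $i$ and all dispatchers are scheduled fairly). **Statement.** Let $n\ge 2$ and let $\mathcal I$ be an obstruction-free linearizable implementation of a register in TSO for $n$ processes. Then for every $m>0$ there is a run $r_m$ of $\mathcal I$ in which exactly $m$ $\mathsf{Write}$ operations are invoked, all of them complete, and each of them performs a fence $\mathtt F$ or an $\mathtt{RMW}$ between its invocation and its response. Moreover, $r_m$ can be chosen fair: every nonempty buffer is eventually propagated from, and every process that from some time on always has an enabled non-null action allowed by its protocol eventually moves. -/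

import Mathlib

namespace TSO

/-- Operations of a multi-writer multi-reader register with values in `V`. -/
inductive RegOp (V : Type*) where
  | read : RegOp V
  | write (v : V) : RegOp V

/-- Responses of a register: a write is acknowledged, a read returns a value. -/
inductive RegResp (V : Type*) where
  | ack : RegResp V
  | val (v : V) : RegResp V

/-- The non-null actions of a process: read, write, fence, read-modify-write,
the response `return`, and further internal actions drawn from a type `A`.
The null action is represented by `none : Option (Act Var Val V A)`. -/
inductive Act (Var Val V A : Type*) where
  | read (x : Var) : Act Var Val V A
  | write (x : Var) (v : Val) : Act Var Val V A
  | fence : Act Var Val V A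
  | rmw (x : Var) (vexp vnew : Val) : Act Var Val V A
  | ret (resp : RegResp V) : Act Var Val V A
  | internal (a : A) : Act Var Val V A

/-- The records kept in a local state. A read is recorded with the value it returned, but not with
the place (buffer or memory) the value came from. -/
inductive Rec (Var Val V A : Type*) where
  | read (x : Var) (v : Val) : Rec Var Val V A
  | write (x : Var) (v : Val) : Rec Var Val V A
  | fence : Rec Var Val V A
  | rmw (x : Var) (vexp vnew : Val) : Rec Var Val V A
  | ret (resp : RegResp V) : Rec Var Val V A
  | internal (a : A) : Rec Var Val V A
  | invoke (o : RegOp V) : Rec Var Val V A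

/-- A local state is the list of all records so far, the latest record first. -/
abbrev LocalState (Var Val V A : Type*) := List (Rec Var Val V A)

/-- The operation that has been invoked and not yet returned, if there is one. -/
def pendingOp {Var Val V A : Type*} : LocalState Var Val V A → Option (RegOp V)
  | [] => none
  | Rec.invoke o :: _ => some o
  | Rec.ret _ :: _ => none
  | _ :: l => pendingOp l

/-- A basic TSO state: main memory and one FIFO store buffer per process (oldest entry first). -/
structure MemState (n : ℕ) (Var Val : Type*) where
  mem : Var → Val
  buf : Fin n → List (Var × Val)

/-- A global state: a TSO state and a local state for every process. -/
structure GlobalState (n : ℕ) (Var Val V A : Type*) where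
  tso : MemState n Var Val
  loc : Fin n → LocalState Var Val V A

/-- A joint action: an action (possibly null) of every process, the choice for every local
dispatcher whether it performs `prop` or the null action, and at most one invocation by the
environment at every process. -/
structure JointAct (n : ℕ) (Var Val V A : Type*) where
  proc : Fin n → Option (Act Var Val V A)
  disp : Fin n → Bool
  env : Fin n → Option (RegOp V)

/-- Agents: `Sum.inl i` is the process `i`, and `Sum.inr i` is its local dispatcher `d_i`. -/
abbrev Agent (n : ℕ) := Fin n ⊕ Fin n

section Model

variable {n : ℕ} {Var Val V A : Type*} [DecidableEq Var]

/-- The restriction of the store buffer of `i` to the entries for the variable `x`. -/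
def MemState.bufAt (σ : MemState n Var Val) (i : Fin n) (x : Var) : List (Var × Val) :=
  (σ.buf i).filter (fun p => decide (p.1 = x))

/-- The value returned by a read of `x` by `i`: the latest entry for `x` in the buffer of `i`
(read from buffer), and the value in memory if there is no such entry (read from memory). -/
def MemState.readVal (σ : MemState n Var Val) (i : Fin n) (x : Var) : Val :=
  match (σ.bufAt i x).getLast? with
  | some p => p.2
  | none => σ.mem x

/-- Enabledness of an action of a process. Fences and RMWs require an empty buffer, an RMW
moreover requires that memory holds the expected value; everything else is always enabled. -/
def MemState.Enabled (σ : MemState n Var Val) (i : Fin n) : Act Var Val V A → Prop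
  | Act.fence => σ.buf i = []
  | Act.rmw x vexp _ => σ.buf i = [] ∧ σ.mem x = vexp
  | _ => True

/-- The effect of one action of process `i` on the TSO state. -/
def MemState.procStep (σ : MemState n Var Val) (i : Fin n) :
    Option (Act Var Val V A) → MemState n Var Val
  | some (Act.write x v) => { σ with buf := Function.update σ.buf i (σ.buf i ++ [(x, v)]) }
  | some (Act.rmw x _ vnew) => { σ with mem := Function.update σ.mem x vnew }
  | _ => σ

/-- The effect of a `prop` action of the dispatcher of `i` on the TSO state: the oldest entry of
the buffer is moved to memory. -/
def MemState.propStep (σ : MemState n Var Val) (i : Fin n) : MemState n Var Val :=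
  match σ.buf i with
  | [] => σ
  | (x, v) :: β => { mem := Function.update σ.mem x v, buf := Function.update σ.buf i β }

/-- The effect of a joint action on the TSO state: the actions of the processes `1, …, n` and then
those of the dispatchers `d_1, …, d_n` are performed one by one. -/
def MemState.next (σ : MemState n Var Val) (a : JointAct n Var Val V A) : MemState n Var Val :=
  (List.finRange n).foldl (fun τ i => if a.disp i then τ.propStep i else τ)
    ((List.finRange n).foldl (fun τ i => τ.procStep i (a.proc i)) σ)

/-- The record of an action of process `i` performed in the TSO state `σ`. -/
def MemState.record (σ : MemState n Var Val) (i : Fin n) : Act Var Val V A → Rec Var Val V A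
  | Act.read x => Rec.read x (σ.readVal i x)
  | Act.write x v => Rec.write x v
  | Act.fence => Rec.fence
  | Act.rmw x vexp vnew => Rec.rmw x vexp vnew
  | Act.ret resp => Rec.ret resp
  | Act.internal a => Rec.internal a

/-- The global state that results from a joint action. In every local state the record of the
action of the process comes before that of an invocation in the same round. -/
def GlobalState.next (g : GlobalState n Var Val V A) (a : JointAct n Var Val V A) :
    GlobalState n Var Val V A where
  tso := g.tso.next a
  loc := fun i =>
    ((a.env i).map Rec.invoke).toList ++ ((a.proc i).map (g.tso.record i)).toList ++ g.loc i

/-- In the joint action `a` performed at `σ`, the agent reads `x` from memory. -/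
def ReadsFromMem (σ : MemState n Var Val) (a : JointAct n Var Val V A) (x : Var) :
    Agent n → Prop
  | Sum.inl i => a.proc i = some (Act.read x) ∧ σ.bufAt i x = []
  | Sum.inr _ => False

/-- In the joint action `a` performed at `σ`, the agent performs a memory access of `x`:
an RMW on `x`, a `prop` of an entry for `x`, or a read of `x` from memory. -/
def Accesses (σ : MemState n Var Val) (a : JointAct n Var Val V A) (x : Var) : Agent n → Prop
  | Sum.inl i => (∃ vexp vnew, a.proc i = some (Act.rmw x vexp vnew)) ∨
      ReadsFromMem σ a x (Sum.inl i)
  | Sum.inr i => a.disp i = true ∧ ∃ v β, σ.buf i = (x, v) :: β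

/-- One of the two agents is a dispatcher that performs `prop`, and the other one is the
corresponding process, reading `x` from memory. -/
def OwnPropRead (σ : MemState n Var Val) (a : JointAct n Var Val V A) (x : Var)
    (b c : Agent n) : Prop :=
  ∃ i, a.disp i = true ∧ ReadsFromMem σ a x (Sum.inl i) ∧
    ((b = Sum.inr i ∧ c = Sum.inl i) ∨ (b = Sum.inl i ∧ c = Sum.inr i))

/-- The actions of the agents `b` and `c` in the joint action `a` are conflicting. -/
def Conflict (σ : MemState n Var Val) (a : JointAct n Var Val V A) (b c : Agent n) : Prop :=
  ∃ x, Accesses σ a x b ∧ Accesses σ a x c ∧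
    ¬ (ReadsFromMem σ a x b ∧ ReadsFromMem σ a x c) ∧ ¬ OwnPropRead σ a x b c

/-- The joint action `a` may take place at the TSO state `σ`: each of its actions is enabled at
`σ`, and no two of them are conflicting. -/
structure JointEnabled (σ : MemState n Var Val) (a : JointAct n Var Val V A) : Prop where
  proc_enabled : ∀ i α, a.proc i = some α → σ.Enabled i α
  disp_enabled : ∀ i, a.disp i = true → σ.buf i ≠ []
  nonconflicting : ∀ b c, b ≠ c → ¬ Conflict σ a b c

end Model

/-- A register implementation for `n` processes: a (nondeterministic) protocol, which assigns a
nonempty set of possible actions to every process and local state, and the initial contents of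
memory. -/
structure Implementation (n : ℕ) (Var Val V A : Type*) where
  prot : Fin n → LocalState Var Val V A → Set (Option (Act Var Val V A))
  prot_nonempty : ∀ i l, (prot i l).Nonempty
  initMem : Var → Val

section Runs

variable {n : ℕ} {Var Val V A : Type*} [DecidableEq Var]

/-- A run of an implementation: an infinite sequence of global states, with the joint action `act t`
leading from time `t` to time `t + 1`. The environment invokes an operation only at a
process without a pending operation, and invokes the writing of any given value at most once. -/
structure Run (I : Implementation n Var Val V A) where
  state : ℕ → GlobalState n Var Val V A
  act : ℕ → JointAct n Var Val V A
  init_mem : (state 0).tso.mem = I.initMem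
  init_buf : ∀ i, (state 0).tso.buf i = []
  init_loc : ∀ i, (state 0).loc i = []
  enabled : ∀ t, JointEnabled (state t).tso (act t)
  step : ∀ t, state (t + 1) = (state t).next (act t)
  consistent : ∀ t i α, (act t).proc i = some α → some α ∈ I.prot i ((state t).loc i)
  invoke_idle : ∀ t i o, (act t).env i = some o → pendingOp ((state t).loc i) = none
  write_once : ∀ t i t' i' v, (act t).env i = some (RegOp.write v) →
    (act t').env i' = some (RegOp.write v) → t = t' ∧ i = i'

variable {I : Implementation n Var Val V A}

/-- Operations of a run are named by their process and their starting time. -/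
abbrev OpId (n : ℕ) := Fin n × ℕ

/-- The operation `X` is an invocation of `o`: the environment invokes `o` at process `X.1` in the
round from time `X.2` to time `X.2 + 1`. -/
def Run.Invoked (r : Run I) (X : OpId n) (o : RegOp V) : Prop :=
  (r.act X.2).env X.1 = some o

/-- The operation `X` completes with response `resp` and ending time `e`: its matching `return`
takes place in the round from time `e - 1` to time `e`. -/
def Run.EndsAt (r : Run I) (X : OpId n) (e : ℕ) (resp : RegResp V) : Prop :=
  (∃ o, r.Invoked X o) ∧ ∃ t, e = t + 1 ∧ X.2 < t ∧
    (r.act t).proc X.1 = some (Act.ret resp) ∧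
    ∀ t', X.2 < t' → t' < t → ∀ resp', (r.act t').proc X.1 ≠ some (Act.ret resp')

/-- `X` precedes `Y`: `X` ends before `Y` starts, or both are operations of the same process
and `X` is the earlier one (program order). -/
def Run.Precedes (r : Run I) (X Y : OpId n) : Prop :=
  (∃ e resp, r.EndsAt X e resp ∧ e < Y.2) ∨ (X.1 = Y.1 ∧ X.2 < Y.2)

/-- The sequential specification of a register that currently holds the value `v`. -/
def Legal : V → List (RegOp V × RegResp V) → Prop
  | _, [] => True
  | v, (RegOp.read, RegResp.val w) :: l => w = v ∧ Legal v l
  | _, (RegOp.write w, RegResp.ack) :: l => Legal w l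
  | _, _ :: _ => False

/-- The history of `r` up to time `T` is linearizable with respect to a register with default
value `v₀`. It is well-formed (a process returns only when it has a pending operation), and there is
a legal sequential history that consists of all completed and some of the pending operations,
gives every completed operation the response it has in `r`, and extends the precedence order. -/
def Run.LinearizableUpTo (r : Run I) (v₀ : V) (T : ℕ) : Prop :=
  (∀ t < T, ∀ i resp, (r.act t).proc i = some (Act.ret resp) →
    pendingOp ((r.state t).loc i) ≠ none) ∧
  ∃ L : List (OpId n × RegOp V × RegResp V),
    (L.map Prod.fst).Nodup ∧
    (∀ p ∈ L, p.1.2 < T ∧ r.Invoked p.1 p.2.1) ∧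
    (∀ X e resp, e ≤ T → r.EndsAt X e resp → ∃ o, (X, o, resp) ∈ L) ∧
    L.Pairwise (fun p q => ¬ r.Precedes q.1 p.1) ∧
    Legal v₀ (L.map Prod.snd)

/-- Every finite history of the implementation is linearizable. -/
def Implementation.Linearizable (I : Implementation n Var Val V A) (v₀ : V) : Prop :=
  ∀ (r : Run I) (T : ℕ), r.LinearizableUpTo v₀ T

/-- Every enabled `prop` action is eventually performed. -/
def Run.PropFair (r : Run I) : Prop :=
  ∀ i t, (r.state t).tso.buf i ≠ [] → ∃ t' ≥ t, (r.act t').disp i = true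

/-- If from some time on process `i` always has an enabled non-null action that its
protocol allows, then it eventually moves. -/
def Run.ProcFair (r : Run I) (i : Fin n) : Prop :=
  ∀ t, (∀ t' ≥ t, ∃ α, some α ∈ I.prot i ((r.state t').loc i) ∧ (r.state t').tso.Enabled i α) →
    ∃ t' ≥ t, (r.act t').proc i ≠ none

/-- A run is fair if all dispatchers and all processes are treated fairly. -/
def Run.Fair (r : Run I) : Prop :=
  r.PropFair ∧ ∀ i, r.ProcFair i

/-- An implementation is obstruction-free if a process completes its pending operation
whenever from some time on no other process takes steps (and the process itself
and all dispatchers are treated fairly). -/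
def Implementation.ObstructionFree (I : Implementation n Var Val V A) : Prop :=
  ∀ (r : Run I) (X : OpId n) (o : RegOp V) (T : ℕ), r.Invoked X o →
    (∀ t ≥ T, ∀ j, j ≠ X.1 → (r.act t).proc j = none) →
    r.PropFair → r.ProcFair X.1 → ∃ e resp, r.EndsAt X e resp

/-- `X` is a `Write` operation of the run. -/
def Run.IsWrite (r : Run I) (X : OpId n) : Prop :=
  ∃ v, r.Invoked X (RegOp.write v)

/-- `X` completes, and between its invocation and its response its process performs a
fence or an RMW. -/
def Run.CompletesWithSync (r : Run I) (X : OpId n) : Prop :=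
  ∃ e resp, r.EndsAt X e resp ∧ ∃ t, X.2 < t ∧ t < e ∧
    ((r.act t).proc X.1 = some Act.fence ∨
      ∃ x vexp vnew, (r.act t).proc X.1 = some (Act.rmw x vexp vnew))

end Runs

end TSO

/-! ### Single-agent steps and their effect on global states. -/

namespace TSO

/-! A write that performs no fence and no RMW can be kept invisible to every other process by
holding its stores back in the buffer. Start from a state with empty buffers and no pending
operation, and let `p` execute a write of `v` alone; obstruction-freedom makes it return
(`exists_solo`). Propagating an entry never changes what its owner reads, so if the write does not
synchronize, `p` can take the same actions with every propagation suppressed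
(`GlobalState.Delayed.next`, `GlobalState.Delayed.ok`). The write then returns with memory
unchanged. A process `q` that now reads alone cannot distinguish this situation from the one before
the write (`GlobalState.AgreeFor.next`), so it returns what it would have returned without the
write. Since `V` is infinite, `v` can be chosen different from that response and from all values
written before. But the read starts after the write has ended and every other operation is an
earlier one of `p`, so linearizability forces it to return `v` (`IsExec.read_eq`). This
contradiction is `exists_sync`. The spliced execution may leave the stores of `p` in the buffer
forever, which is harmless because linearizability is required of all runs, fair or not. The read of
`q` is only a thought experiment and does not enter the constructed run. After each write the buffer
of `p` is flushed (`exists_flush`), which restores the situation needed for the next write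
(`SyncWrites.succ`). After `m` writes the execution is continued by a fair scheduler without
invocations (`exists_fair`). -/

/-- A step of an interleaving execution: at most one agent acts. -/
inductive Step (n : ℕ) (Var Val V A : Type*) where
  | idle : Step n Var Val V A
  | proc (i : Fin n) (α : Act Var Val V A) : Step n Var Val V A
  | prop (i : Fin n) : Step n Var Val V A
  | invoke (i : Fin n) (o : RegOp V) : Step n Var Val V A

/-- The joint action in which a single step is performed. -/
def Step.toJoint {n : ℕ} {Var Val V A : Type*} : Step n Var Val V A → JointAct n Var Val V A
  | .idle => ⟨fun _ => none, fun _ => false, fun _ => none⟩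
  | .proc i α => ⟨fun j => if j = i then some α else none, fun _ => false, fun _ => none⟩
  | .prop i => ⟨fun _ => none, fun j => decide (j = i), fun _ => none⟩
  | .invoke i o => ⟨fun _ => none, fun _ => false, fun j => if j = i then some o else none⟩

/-- The step concerns only process `i` and its dispatcher. -/
def Step.By {n : ℕ} {Var Val V A : Type*} (i : Fin n) : Step n Var Val V A → Prop
  | .idle => True
  | .proc j _ => j = i
  | .prop j => j = i
  | .invoke j _ => j = i

/-- The step with propagation suppressed. -/
def Step.delay {n : ℕ} {Var Val V A : Type*} : Step n Var Val V A → Step n Var Val V A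
  | .prop _ => .idle
  | s => s

/-- The action is a fence or an RMW. -/
def Act.IsSync {Var Val V A : Type*} : Act Var Val V A → Prop
  | .fence => True
  | .rmw _ _ _ => True
  | _ => False

section StepBasics

variable {n : ℕ} {Var Val V A : Type*}

theorem Act.IsSync.eq_fence_or_rmw {α : Act Var Val V A} (h : α.IsSync) :
    α = .fence ∨ ∃ x vexp vnew, α = .rmw x vexp vnew := by
  cases α <;> simp_all [Act.IsSync]

theorem Step.toJoint_proc_eq_some {s : Step n Var Val V A} {i : Fin n} {α : Act Var Val V A} :
    s.toJoint.proc i = some α ↔ s = .proc i α := by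
  cases s <;> simp [Step.toJoint]
  grind

theorem Step.toJoint_disp_eq_true {s : Step n Var Val V A} {i : Fin n} :
    s.toJoint.disp i = true ↔ s = .prop i := by
  cases s <;> simp [Step.toJoint]
  grind

theorem Step.toJoint_env_eq_some {s : Step n Var Val V A} {i : Fin n} {o : RegOp V} :
    s.toJoint.env i = some o ↔ s = .invoke i o := by
  cases s <;> simp [Step.toJoint]
  grind

theorem foldl_eq_self {σ ι : Type*} (f : σ → ι → σ) (l : List ι) (hf : ∀ τ, ∀ j ∈ l, f τ j = τ)
    (s : σ) : l.foldl f s = s := by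
  induction l generalizing s with
  | nil => rfl
  | cons a l ih =>
    rw [List.foldl_cons, hf s a (by simp)]
    exact ih (fun τ j hj => hf τ j (by simp [hj])) s

/-- Collapses the folds in `MemState.next` over all processes or dispatchers to the only one that
acts. -/
theorem foldl_eq_single {σ ι : Type*} (f : σ → ι → σ) (l : List ι) (i : ι) (hl : l.Nodup)
    (hi : i ∈ l) (hf : ∀ τ j, j ≠ i → f τ j = τ) (s : σ) : l.foldl f s = f s i := by
  induction l generalizing s with
  | nil => simp at hi
  | cons a l ih =>
    rw [List.nodup_cons] at hl
    by_cases h : a = i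
    · subst h
      exact foldl_eq_self f l (fun τ j hj => hf τ j (by rintro rfl; exact hl.1 hj)) _
    · rw [List.foldl_cons, hf s a h]
      exact ih hl.2 (by simpa [Ne.symm h] using hi) s

variable [DecidableEq Var]

theorem GlobalState.next_idle (g : GlobalState n Var Val V A) :
    g.next (Step.idle : Step n Var Val V A).toJoint = g := by
  simp [GlobalState.next, MemState.next, Step.toJoint, MemState.procStep]

theorem GlobalState.next_proc (g : GlobalState n Var Val V A) (i : Fin n) (α : Act Var Val V A) :
    g.next (Step.proc i α).toJoint = ⟨g.tso.procStep i (some α),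
      Function.update g.loc i (g.tso.record i α :: g.loc i)⟩ := by
  have h : (g.next (Step.proc i α).toJoint).tso = g.tso.procStep i (some α) := by
    simp only [GlobalState.next, MemState.next, Step.toJoint]
    rw [foldl_eq_self _ _ (by simp), foldl_eq_single _ _ i (List.nodup_finRange n) (by simp)]
    · simp
    · intro τ j hj
      simp [hj, MemState.procStep]
  have h' : (g.next (Step.proc i α).toJoint).loc =
      Function.update g.loc i (g.tso.record i α :: g.loc i) := by
    funext j
    by_cases hj : j = i
    · subst hj
      simp [GlobalState.next, Step.toJoint]
    · simp [GlobalState.next, Step.toJoint, hj]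
  rw [← h, ← h']

theorem GlobalState.next_prop (g : GlobalState n Var Val V A) (i : Fin n) :
    g.next (Step.prop i : Step n Var Val V A).toJoint = ⟨g.tso.propStep i, g.loc⟩ := by
  have h : (g.next (Step.prop i : Step n Var Val V A).toJoint).tso = g.tso.propStep i := by
    simp only [GlobalState.next, MemState.next, Step.toJoint]
    rw [foldl_eq_single _ _ i (List.nodup_finRange n) (by simp),
      foldl_eq_self _ _ (by simp [MemState.procStep])]
    · simp
    · intro τ j hj
      simp [hj]
  have h' : (g.next (Step.prop i : Step n Var Val V A).toJoint).loc = g.loc := by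
    funext j
    simp [GlobalState.next, Step.toJoint]
  rw [← h, ← h']

theorem GlobalState.next_invoke (g : GlobalState n Var Val V A) (i : Fin n) (o : RegOp V) :
    g.next (Step.invoke i o : Step n Var Val V A).toJoint =
      ⟨g.tso, Function.update g.loc i (.invoke o :: g.loc i)⟩ := by
  have h : (g.next (Step.invoke i o : Step n Var Val V A).toJoint).tso = g.tso := by
    simp only [GlobalState.next, MemState.next, Step.toJoint]
    rw [foldl_eq_self _ _ (by simp), foldl_eq_self _ _ (by simp [MemState.procStep])]
  have h' : (g.next (Step.invoke i o : Step n Var Val V A).toJoint).loc =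
      Function.update g.loc i (.invoke o :: g.loc i) := by
    funext j
    by_cases hj : j = i
    · subst hj
      simp [GlobalState.next, Step.toJoint]
    · simp [GlobalState.next, Step.toJoint, hj]
  rw [← h, ← h']

theorem MemState.readVal_procStep_write (σ : MemState n Var Val) (i : Fin n) (x y : Var)
    (v : Val) : (σ.procStep i (some (.write x v : Act Var Val V A))).readVal i y =
      if y = x then v else σ.readVal i y := by
  by_cases h : y = x
  · subst h
    simp [MemState.readVal, MemState.bufAt, MemState.procStep]
  · simp [MemState.readVal, MemState.bufAt, MemState.procStep, h, Ne.symm h]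

/-- If the propagated entry is the only one for `y`, memory receives its value; if there are others,
the latest of them stays in the buffer and still decides. This is why propagation is invisible to
the owner of the buffer. -/
theorem MemState.readVal_propStep (σ : MemState n Var Val) (i : Fin n) (y : Var) :
    (σ.propStep i).readVal i y = σ.readVal i y := by
  rcases h : σ.buf i with _ | ⟨⟨x, v⟩, β⟩
  · simp [MemState.propStep, h]
  · by_cases hy : y = x
    · subst hy
      simp only [MemState.readVal, MemState.bufAt, MemState.propStep, h, Function.update_self,
        decide_true, List.filter_cons_of_pos, List.getLast?_cons]
      cases List.getLast? (List.filter (fun p => decide (p.1 = y)) β) <;> simp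
    · simp [MemState.readVal, MemState.bufAt, MemState.propStep, h, hy, Ne.symm hy]

theorem MemState.procStep_buf_of_ne (σ : MemState n Var Val) {i j : Fin n} (hj : j ≠ i)
    (o : Option (Act Var Val V A)) : (σ.procStep i o).buf j = σ.buf j := by
  rcases o with _ | α
  · rfl
  · cases α <;> simp [MemState.procStep, hj]

theorem MemState.propStep_buf_of_ne (σ : MemState n Var Val) {i j : Fin n} (hj : j ≠ i) :
    (σ.propStep i).buf j = σ.buf j := by
  rcases h : σ.buf i with _ | ⟨⟨x, v⟩, β⟩ <;> simp [MemState.propStep, h, hj]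

theorem MemState.propStep_buf_self (σ : MemState n Var Val) (i : Fin n) :
    (σ.propStep i).buf i = (σ.buf i).tail := by
  rcases h : σ.buf i with _ | ⟨⟨x, v⟩, β⟩ <;> simp [MemState.propStep, h]

theorem MemState.procStep_buf_ne_nil (σ : MemState n Var Val) (i j : Fin n)
    (o : Option (Act Var Val V A)) (h : σ.buf j ≠ []) : (σ.procStep i o).buf j ≠ [] := by
  by_cases hj : j = i
  · subst hj
    rcases o with _ | α
    · exact h
    · cases α <;> simp [MemState.procStep, h]
  · rwa [MemState.procStep_buf_of_ne σ hj]

theorem GlobalState.next_buf_ne_nil (g : GlobalState n Var Val V A) (s : Step n Var Val V A)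
    (i : Fin n) (h : g.tso.buf i ≠ []) (hs : s ≠ .prop i) :
    (g.next s.toJoint).tso.buf i ≠ [] := by
  rcases s with _ | ⟨j, α⟩ | j | ⟨j, o⟩
  · rwa [GlobalState.next_idle]
  · rw [GlobalState.next_proc]
    exact g.tso.procStep_buf_ne_nil _ _ _ h
  · rw [GlobalState.next_prop]
    rwa [MemState.propStep_buf_of_ne]
    rintro rfl
    exact hs rfl
  · rwa [GlobalState.next_invoke]

theorem GlobalState.next_buf_of_by (g : GlobalState n Var Val V A) {s : Step n Var Val V A}
    {i j : Fin n} (hs : s.By i) (hj : j ≠ i) :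
    (g.next s.toJoint).tso.buf j = g.tso.buf j := by
  rcases s with _ | ⟨k, α⟩ | k | ⟨k, o⟩ <;> simp only [Step.By] at hs <;> try subst hs
  · rw [GlobalState.next_idle]
  · rw [GlobalState.next_proc]
    exact g.tso.procStep_buf_of_ne hj _
  · rw [GlobalState.next_prop]
    exact g.tso.propStep_buf_of_ne hj
  · rw [GlobalState.next_invoke]

theorem GlobalState.next_loc_of_by (g : GlobalState n Var Val V A) {s : Step n Var Val V A}
    {i j : Fin n} (hs : s.By i) (hj : j ≠ i) :
    (g.next s.toJoint).loc j = g.loc j := by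
  rcases s with _ | ⟨k, α⟩ | k | ⟨k, o⟩ <;> simp only [Step.By] at hs <;> try subst hs
  · rw [GlobalState.next_idle]
  · rw [GlobalState.next_proc]
    simp [hj]
  · rw [GlobalState.next_prop]
  · rw [GlobalState.next_invoke]
    simp [hj]

/-! ### Admissible steps. -/

/-- The step may be taken in the given global state. -/
def Step.Ok (I : Implementation n Var Val V A) (g : GlobalState n Var Val V A) :
    Step n Var Val V A → Prop
  | .idle => True
  | .proc i α => some α ∈ I.prot i (g.loc i) ∧ g.tso.Enabled i α
  | .prop i => g.tso.buf i ≠ []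
  | .invoke i _ => pendingOp (g.loc i) = none

/-- Conflicts need two distinct agents accessing memory in one round, but an access by an agent
determines the step. -/
theorem Step.Ok.jointEnabled {I : Implementation n Var Val V A} {g : GlobalState n Var Val V A}
    {s : Step n Var Val V A} (h : s.Ok I g) : JointEnabled g.tso s.toJoint where
  proc_enabled i α hα := by
    rw [Step.toJoint_proc_eq_some] at hα
    subst hα
    exact h.2
  disp_enabled i hi := by
    rw [Step.toJoint_disp_eq_true] at hi
    subst hi
    exact h
  nonconflicting b c hbc := by
    rintro ⟨x, hb, hc, -, -⟩
    have key : ∀ d : Agent n, Accesses g.tso s.toJoint x d →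
        (∃ i α, d = .inl i ∧ s = .proc i α) ∨ ∃ i, d = .inr i ∧ s = .prop i := by
      rintro (i | i) hd
      · rcases hd with ⟨_, _, hd⟩ | ⟨hd, -⟩
        · exact .inl ⟨i, _, rfl, Step.toJoint_proc_eq_some.1 hd⟩
        · exact .inl ⟨i, _, rfl, Step.toJoint_proc_eq_some.1 hd⟩
      · exact .inr ⟨i, rfl, Step.toJoint_disp_eq_true.1 hd.1⟩
    rcases key b hb with ⟨i, α, rfl, rfl⟩ | ⟨i, rfl, rfl⟩ <;>
      rcases key c hc with ⟨j, β, rfl, hj⟩ | ⟨j, rfl, hj⟩ <;> simp_all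

/-! ### Indistinguishability, and delaying the stores of one process. -/

/-- The two global states look the same to process `i` and its dispatcher. -/
def GlobalState.AgreeFor (i : Fin n) (g g' : GlobalState n Var Val V A) : Prop :=
  g.tso.mem = g'.tso.mem ∧ g.tso.buf i = g'.tso.buf i ∧ g.loc i = g'.loc i

/-- The buffers of the other processes may differ: steps of `i` and its dispatcher depend only on
memory, the buffer of `i` and its local state. -/
theorem GlobalState.AgreeFor.next {i : Fin n} {g g' : GlobalState n Var Val V A}
    (h : g.AgreeFor i g') {s : Step n Var Val V A} (hs : s.By i) :
    (g.next s.toJoint).AgreeFor i (g'.next s.toJoint) := by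
  obtain ⟨h1, h2, h3⟩ := h
  rcases s with _ | ⟨k, α⟩ | k | ⟨k, o⟩ <;> simp only [Step.By] at hs <;> try subst hs
  · simp only [GlobalState.next_idle]
    exact ⟨h1, h2, h3⟩
  · simp only [GlobalState.next_proc, GlobalState.AgreeFor]
    cases α <;> simp [MemState.procStep, MemState.record, MemState.readVal, MemState.bufAt,
      h1, h2, h3]
  · simp only [GlobalState.next_prop, GlobalState.AgreeFor, MemState.propStep, h2]
    rcases h : g'.tso.buf k with _ | ⟨⟨x, v⟩, β⟩ <;> simp [h1, h2, h3, h]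
  · simp only [GlobalState.next_invoke, GlobalState.AgreeFor]
    simp [h1, h2, h3]

omit [DecidableEq Var] in
theorem GlobalState.AgreeFor.ok {I : Implementation n Var Val V A} {i : Fin n}
    {g g' : GlobalState n Var Val V A} (h : g.AgreeFor i g') {s : Step n Var Val V A}
    (hs : s.By i) (hok : s.Ok I g) : s.Ok I g' := by
  obtain ⟨h1, h2, h3⟩ := h
  rcases s with _ | ⟨k, α⟩ | k | ⟨k, o⟩ <;> simp only [Step.By] at hs <;> try subst hs
  · trivial
  · simp only [Step.Ok] at *
    refine ⟨h3 ▸ hok.1, ?_⟩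
    cases α <;> simp_all [MemState.Enabled]
  · simpa only [Step.Ok, h2] using hok
  · simpa only [Step.Ok, h3] using hok

/-- The state `g'` is a version of `g` in which the stores of process `i` are delayed. -/
def GlobalState.Delayed (i : Fin n) (g g' : GlobalState n Var Val V A) : Prop :=
  g.loc = g'.loc ∧ ∀ x, g.tso.readVal i x = g'.tso.readVal i x

/-- A local state records the value of a read but not whether it came from the buffer or from
memory, so equal read values give equal histories. Writes change the readable values of both states
alike, and propagation changes them in neither. -/
theorem GlobalState.Delayed.next {i : Fin n} {g g' : GlobalState n Var Val V A}
    (h : g.Delayed i g') {s : Step n Var Val V A} (hs : s.By i)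
    (hsync : ∀ α, s = .proc i α → ¬ α.IsSync) :
    (g.next s.toJoint).Delayed i (g'.next s.delay.toJoint) := by
  obtain ⟨h1, h2⟩ := h
  rcases s with _ | ⟨k, α⟩ | k | ⟨k, o⟩ <;> simp only [Step.By] at hs <;> try subst hs
  · simp only [Step.delay, GlobalState.next_idle]
    exact ⟨h1, h2⟩
  · have := hsync α rfl
    simp only [Step.delay, GlobalState.next_proc, GlobalState.Delayed]
    cases α with
    | write x v =>
      refine ⟨by simp [MemState.record, h1], fun y => ?_⟩
      simp only [MemState.readVal_procStep_write, h2]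
    | fence => simp [Act.IsSync] at this
    | rmw x a b => simp [Act.IsSync] at this
    | _ => simp [MemState.procStep, MemState.record, h1, h2]
  · simp only [Step.delay, GlobalState.next_prop, GlobalState.next_idle, GlobalState.Delayed]
    exact ⟨h1, fun y => by simp [MemState.readVal_propStep, h2]⟩
  · simp only [Step.delay, GlobalState.next_invoke, GlobalState.Delayed]
    simp [h1, h2]

/-- Only fences and RMWs have an enabling condition on buffers or memory, and these are excluded;
the protocol sees only the local state. -/
theorem GlobalState.Delayed.ok {I : Implementation n Var Val V A} {i : Fin n}
    {g g' : GlobalState n Var Val V A} (h : g.Delayed i g') {s : Step n Var Val V A}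
    (hsync : ∀ α, s = .proc i α → ¬ α.IsSync) (hs : s.By i) (hok : s.Ok I g) :
    s.delay.Ok I g' := by
  obtain ⟨h1, h2⟩ := h
  rcases s with _ | ⟨k, α⟩ | k | ⟨k, o⟩ <;> simp only [Step.By] at hs <;> try subst hs
  · trivial
  · have := hsync α rfl
    simp only [Step.delay, Step.Ok] at *
    refine ⟨h1 ▸ hok.1, ?_⟩
    cases α <;> simp_all [MemState.Enabled, Act.IsSync]
  · trivial
  · simpa only [Step.delay, Step.Ok, h1] using hok

theorem GlobalState.next_delay_mem (g : GlobalState n Var Val V A) {i : Fin n}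
    {s : Step n Var Val V A} (hs : s.By i) (hsync : ∀ α, s = .proc i α → ¬ α.IsSync) :
    (g.next s.delay.toJoint).tso.mem = g.tso.mem := by
  rcases s with _ | ⟨k, α⟩ | k | ⟨k, o⟩ <;> simp only [Step.By] at hs <;> try subst hs
  · simp [Step.delay, GlobalState.next_idle]
  · have := hsync α rfl
    simp only [Step.delay, GlobalState.next_proc]
    cases α <;> simp_all [MemState.procStep, Act.IsSync]
  · simp [Step.delay, GlobalState.next_idle]
  · simp [Step.delay, GlobalState.next_invoke]

omit [DecidableEq Var] in
theorem Step.By.delay {i : Fin n} {s : Step n Var Val V A} (hs : s.By i) : s.delay.By i := by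
  cases s <;> simp_all [Step.By, Step.delay]

end StepBasics

end TSO

/-! ### Interleaving executions as runs. -/

namespace TSO

section Executions

variable {n : ℕ} {Var Val V A : Type*} [DecidableEq Var]

/-- The initial global state of an implementation. -/
def Implementation.init (I : Implementation n Var Val V A) : GlobalState n Var Val V A :=
  ⟨⟨I.initMem, fun _ => []⟩, fun _ => []⟩

/-- The global states reached by a sequence of steps from the initial state. -/
def exec (I : Implementation n Var Val V A) (a : ℕ → Step n Var Val V A) :
    ℕ → GlobalState n Var Val V A
  | 0 => I.init
  | t + 1 => (exec I a t).next (a t).toJoint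

/-- The sequence of steps is an interleaving execution of the implementation. -/
structure IsExec (I : Implementation n Var Val V A) (a : ℕ → Step n Var Val V A) : Prop where
  ok : ∀ t, (a t).Ok I (exec I a t)
  once : ∀ t t' i i' v, a t = .invoke i (.write v) → a t' = .invoke i' (.write v) → t = t'

variable {I : Implementation n Var Val V A} {a b : ℕ → Step n Var Val V A} {i : Fin n}

/-- The run given by an interleaving execution. -/
def IsExec.toRun (h : IsExec I a) : Run I where
  state := exec I a
  act t := (a t).toJoint
  init_mem := rfl
  init_buf _ := rfl
  init_loc _ := rfl
  enabled t := (h.ok t).jointEnabled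
  step _ := rfl
  consistent t i α hα := by
    have := h.ok t
    rw [Step.toJoint_proc_eq_some.1 hα] at this
    exact this.1
  invoke_idle t i o ho := by
    have := h.ok t
    rw [Step.toJoint_env_eq_some.1 ho] at this
    exact this
  write_once t i t' i' v h1 h2 := by
    rw [Step.toJoint_env_eq_some] at h1 h2
    have ht := h.once _ _ _ _ _ h1 h2
    subst ht
    rw [h1] at h2
    cases h2
    exact ⟨rfl, rfl⟩

theorem IsExec.toRun_invoked (h : IsExec I a) {X : OpId n} {o : RegOp V} :
    h.toRun.Invoked X o ↔ a X.2 = .invoke X.1 o :=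
  Step.toJoint_env_eq_some

/-- The operation of process `i` that starts at time `s` returns `resp` in the step at time `t`. -/
def ReturnsAt (a : ℕ → Step n Var Val V A) (i : Fin n) (s t : ℕ) (resp : RegResp V) : Prop :=
  s < t ∧ a t = .proc i (.ret resp) ∧ ∀ t', s < t' → t' < t → ∀ r, a t' ≠ .proc i (.ret r)

theorem IsExec.toRun_endsAt (h : IsExec I a) {X : OpId n} {e : ℕ} {resp : RegResp V} :
    h.toRun.EndsAt X e resp ↔ (∃ o, a X.2 = .invoke X.1 o) ∧
      ∃ t, e = t + 1 ∧ ReturnsAt a X.1 X.2 t resp := by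
  simp only [Run.EndsAt, IsExec.toRun_invoked, ReturnsAt]
  simp only [IsExec.toRun, Step.toJoint_proc_eq_some, ne_eq]

theorem exec_congr {T : ℕ} (h : ∀ t < T, a t = b t) {t : ℕ} (ht : t ≤ T) :
    exec I a t = exec I b t := by
  induction t with
  | zero => rfl
  | succ t ih => rw [exec, exec, ih (by omega), h t (by omega)]

/-- From time `T` on, the steps of an execution can be chosen depending on the current state. -/
theorem exists_exec_policy (I : Implementation n Var Val V A) (a : ℕ → Step n Var Val V A) (T : ℕ)
    (π : ℕ → GlobalState n Var Val V A → Step n Var Val V A) :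
    ∃ b : ℕ → Step n Var Val V A, (∀ t < T, b t = a t) ∧ ∀ t ≥ T, b t = π t (exec I b t) := by
  -- The steps depend on states that depend on earlier steps; the states `S` are built by recursion
  -- first and the steps are read off from them.
  let P : ℕ → GlobalState n Var Val V A → Step n Var Val V A := fun t g => if t < T then a t else π t g
  let S : ℕ → GlobalState n Var Val V A :=
    fun t => Nat.rec I.init (fun t g => g.next (P t g).toJoint) t
  have hS : ∀ t, exec I (fun t => P t (S t)) t = S t := by
    intro t
    induction t with
    | zero => rfl
    | succ t ih => rw [exec, ih]
  refine ⟨fun t => P t (S t), fun t ht => by simp [P, ht], fun t ht => ?_⟩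
  rw [hS]
  simp [P, Nat.not_lt.2 ht]

theorem exec_buf_ne_nil {t u : ℕ} (htu : t ≤ u) (h : (exec I a t).tso.buf i ≠ [])
    (hp : ∀ k, t ≤ k → k < u → a k ≠ .prop i) : (exec I a u).tso.buf i ≠ [] := by
  induction u, htu using Nat.le_induction with
  | base => exact h
  | succ u hu ih =>
    exact GlobalState.next_buf_ne_nil _ _ _ (ih fun k h1 h2 => hp k h1 (by omega))
      (hp u hu (by omega))

theorem exec_buf_of_by {T : ℕ} {j : Fin n} (h : ∀ t ≥ T, (a t).By i) (hj : j ≠ i) {t : ℕ}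
    (ht : T ≤ t) : (exec I a t).tso.buf j = (exec I a T).tso.buf j := by
  induction t, ht using Nat.le_induction with
  | base => rfl
  | succ t ht ih => rw [exec, GlobalState.next_buf_of_by _ (h t ht) hj, ih]

theorem exec_loc_of_by {T : ℕ} {j : Fin n} (h : ∀ t ≥ T, (a t).By i) (hj : j ≠ i) {t : ℕ}
    (ht : T ≤ t) : (exec I a t).loc j = (exec I a T).loc j := by
  induction t, ht using Nat.le_induction with
  | base => rfl
  | succ t ht ih => rw [exec, GlobalState.next_loc_of_by _ (h t ht) hj, ih]

/-! ### A fair scheduler. -/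

section Scheduler

open Classical in
/-- The step of a scheduler that gives the turn to `c`, where only processes in `P` take steps. -/
noncomputable def schedStep (I : Implementation n Var Val V A) (P : Set (Fin n))
    (g : GlobalState n Var Val V A) : Option (Agent n) → Step n Var Val V A
  | some (.inl i) =>
    if h : i ∈ P ∧ ∃ α, some α ∈ I.prot i (g.loc i) ∧ g.tso.Enabled i α then .proc i h.2.choose
    else .idle
  | some (.inr i) => if g.tso.buf i ≠ [] then .prop i else .idle
  | none => .idle

omit [DecidableEq Var] in
theorem schedStep_ok (P : Set (Fin n)) (g : GlobalState n Var Val V A) (c : Option (Agent n)) :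
    (schedStep I P g c).Ok I g := by
  rcases c with _ | i | i <;> simp only [schedStep]
  · trivial
  · split_ifs with h
    · exact h.2.choose_spec
    · trivial
  · split_ifs with h
    · exact h
    · trivial

omit [DecidableEq Var] in
theorem schedStep_cases (P : Set (Fin n)) (g : GlobalState n Var Val V A)
    (c : Option (Agent n)) : schedStep I P g c = .idle ∨
      (∃ i ∈ P, ∃ α, schedStep I P g c = .proc i α) ∨
      ∃ i, g.tso.buf i ≠ [] ∧ schedStep I P g c = .prop i := by
  rcases c with _ | i | i <;> simp only [schedStep]
  · simp
  · split_ifs with h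
    · exact .inr (.inl ⟨i, h.1, _, rfl⟩)
    · simp
  · split_ifs with h
    · exact .inr (.inr ⟨i, h, rfl⟩)
    · simp

/-- A schedule in which every agent has the turn infinitely often. -/
def turn (n : ℕ) (t : ℕ) : Option (Agent n) := Encodable.decode t.unpair.1

theorem exists_turn_eq (c : Agent n) (t : ℕ) : ∃ u ≥ t, turn n u = some c :=
  ⟨Nat.pair (Encodable.encode c) t, Nat.right_le_pair _ _, by simp [turn]⟩

/-- From time `T` on, the steps are those of the fair scheduler for the processes in `P`. -/
def Scheduled (I : Implementation n Var Val V A) (P : Set (Fin n)) (T : ℕ)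
    (a : ℕ → Step n Var Val V A) : Prop :=
  ∀ t ≥ T, a t = schedStep I P (exec I a t) (turn n t)

/-- A nonempty buffer stays nonempty until its own dispatcher acts, so it is still nonempty at that
dispatcher's next turn. Dispatchers get turns whatever `P` is. -/
theorem Scheduled.propFair {P : Set (Fin n)} {T : ℕ} (hs : Scheduled I P T a) (h : IsExec I a) :
    h.toRun.PropFair := by
  intro i t ht
  by_contra! hn
  have hn' : ∀ k ≥ t, a k ≠ .prop i := fun k hk e => hn k hk (Step.toJoint_disp_eq_true.2 e)
  obtain ⟨u, hu, hc⟩ := exists_turn_eq (.inr i) (max t T)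
  have hb := exec_buf_ne_nil (u := u) (by omega) ht fun k hk _ => hn' k hk
  have := hs u (by omega)
  rw [hc] at this
  simp only [schedStep, if_pos hb] at this
  exact hn' u (by omega) this

theorem Scheduled.procFair {P : Set (Fin n)} {T : ℕ} (hs : Scheduled I P T a) (h : IsExec I a)
    (hi : i ∈ P) : h.toRun.ProcFair i := by
  intro t ht
  obtain ⟨u, hu, hc⟩ := exists_turn_eq (.inl i) (max t T)
  refine ⟨u, by omega, ?_⟩
  have hb := ht u (by omega)
  have h1 := hs u (by omega)
  rw [hc] at h1
  simp only [schedStep] at h1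
  rw [dif_pos ⟨hi, hb⟩] at h1
  change (a u).toJoint.proc i ≠ none
  rw [Step.toJoint_proc_eq_some.2 h1]
  simp

end Scheduler

/-! ### Solo executions and flushing a buffer. -/

/-- In a state with empty buffers, an obstruction-free implementation lets process `i` execute a
newly invoked operation alone until it returns. -/
theorem exists_solo (hof : I.ObstructionFree) (h : IsExec I a) {T : ℕ} (i : Fin n) (o : RegOp V)
    (hbuf : ∀ j, (exec I a T).tso.buf j = []) (hpend : pendingOp ((exec I a T).loc i) = none)
    (hfresh : ∀ v, o = .write v → ∀ t < T, ∀ j, a t ≠ .invoke j (.write v)) :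
    ∃ b, IsExec I b ∧ (∀ t < T, b t = a t) ∧ b T = .invoke i o ∧
      (∀ t ≥ T, (b t).By i) ∧ (∀ t > T, ∀ j o', b t ≠ .invoke j o') ∧
      ∃ t resp, ReturnsAt b i T t resp := by
  obtain ⟨b, hb1, hb2⟩ := exists_exec_policy I a T
    (fun t g => if t = T then .invoke i o else schedStep I {i} g (turn n t))
  have hT : b T = .invoke i o := by simpa using hb2 T le_rfl
  have hS : Scheduled I {i} (T + 1) b := by
    intro t ht
    rw [hb2 t (by omega), if_neg (by omega)]
  have heq : exec I b T = exec I a T := exec_congr hb1 le_rfl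
  have hinv : ∀ t > T, ∀ j o', b t ≠ .invoke j o' := by
    intro t ht j o'
    rw [hS t ht]
    rcases schedStep_cases (I := I) {i} (exec I b t) (turn n t) with
      e | ⟨_, _, _, e⟩ | ⟨_, _, e⟩ <;> rw [e] <;> simp
  -- The two claims support each other: all dispatchers are scheduled, but the other ones find empty
  -- buffers, and these stay empty as long as only `i` and its dispatcher act.
  have hby : ∀ t ≥ T, (b t).By i ∧ ∀ j ≠ i, (exec I b t).tso.buf j = [] := by
    intro t ht
    induction t, ht using Nat.le_induction with
    | base => exact ⟨by simp [hT, Step.By], fun j _ => by rw [heq, hbuf]⟩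
    | succ t ht ih =>
      have hbuf' : ∀ j ≠ i, (exec I b (t + 1)).tso.buf j = [] := fun j hj => by
        rw [exec, GlobalState.next_buf_of_by _ ih.1 hj, ih.2 j hj]
      refine ⟨?_, hbuf'⟩
      rw [hS (t + 1) (by omega)]
      rcases schedStep_cases (I := I) {i} (exec I b (t + 1)) (turn n (t + 1)) with
        e | ⟨j, hj, _, e⟩ | ⟨j, hj, e⟩ <;> rw [e]
      · trivial
      · exact hj
      · by_contra hji
        exact hj (hbuf' j hji)
  have hex : IsExec I b := by
    constructor
    · intro t
      rcases lt_trichotomy t T with ht | rfl | ht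
      · rw [hb1 t ht, exec_congr hb1 ht.le]
        exact h.ok t
      · rw [hT, heq]
        exact hpend
      · rw [hS t ht]
        exact schedStep_ok _ _ _
    · intro t t' j j' v h1 h2
      have ht : t ≤ T := by
        by_contra hc
        exact hinv t (by omega) _ _ h1
      have ht' : t' ≤ T := by
        by_contra hc
        exact hinv t' (by omega) _ _ h2
      rcases ht.lt_or_eq with ht | rfl <;> rcases ht'.lt_or_eq with ht' | rfl
      · rw [hb1 _ ht] at h1
        rw [hb1 _ ht'] at h2
        exact h.once _ _ _ _ _ h1 h2
      · rw [hT] at h2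
        cases h2
        rw [hb1 _ ht] at h1
        exact absurd h1 (hfresh v rfl t ht _)
      · rw [hT] at h1
        cases h1
        rw [hb1 _ ht'] at h2
        exact absurd h2 (hfresh v rfl t' ht' _)
      · rfl
  refine ⟨b, hex, hb1, hT, fun t ht => (hby t ht).1, hinv, ?_⟩
  obtain ⟨e, resp, he⟩ := hof hex.toRun (i, T) o (T + 1) (hex.toRun_invoked.2 hT)
    (fun t ht j hj => by
      by_contra hc
      obtain ⟨α, hα⟩ := Option.ne_none_iff_exists'.1 hc
      have hα := Step.toJoint_proc_eq_some.1 hα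
      have := (hby t (by omega)).1
      rw [hα] at this
      exact hj this)
    (hS.propFair hex) (hS.procFair hex rfl)
  obtain ⟨-, t, -, ht⟩ := hex.toRun_endsAt.1 he
  exact ⟨t, resp, ht⟩

/-- After the execution has become idle, the stores in the buffer of `i` can be propagated. -/
theorem exists_flush (h : IsExec I a) {T : ℕ} (i : Fin n) :
    ∃ b U, IsExec I b ∧ T ≤ U ∧ (∀ t < T, b t = a t) ∧
      (∀ t ≥ T, b t = .idle ∨ b t = .prop i) ∧ (∀ t ≥ U, b t = .idle) ∧
      (exec I b U).tso.buf i = [] ∧ (exec I b U).loc = (exec I a T).loc ∧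
      ∀ j ≠ i, (exec I b U).tso.buf j = (exec I a T).tso.buf j := by
  classical
  obtain ⟨b, hb1, hb2⟩ := exists_exec_policy I a T
    (fun t g => if g.tso.buf i ≠ [] then .prop i else .idle)
  have heq : exec I b T = exec I a T := exec_congr hb1 le_rfl
  have hcase : ∀ t ≥ T, b t = .idle ∨ b t = .prop i := by
    intro t ht
    rw [hb2 t ht]
    split_ifs <;> simp
  have hby : ∀ t ≥ T, (b t).By i := by
    intro t ht
    rcases hcase t ht with e | e <;> rw [e] <;> simp [Step.By]
  have hlen : ∀ k, ((exec I b (T + k)).tso.buf i).length =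
      ((exec I a T).tso.buf i).length - k := by
    intro k
    induction k with
    | zero => simp [heq]
    | succ k ih =>
      rw [← add_assoc, exec, hb2 (T + k) (by omega)]
      split_ifs with hc
      · rw [GlobalState.next_prop, MemState.propStep_buf_self, List.length_tail, ih]
        omega
      · rw [GlobalState.next_idle, ih]
        rw [not_not] at hc
        rw [hc] at ih
        simp only [List.length_nil] at ih
        omega
  have hnil : ∀ t ≥ T + ((exec I a T).tso.buf i).length, (exec I b t).tso.buf i = [] := by
    intro t ht
    obtain ⟨k, rfl⟩ := Nat.exists_eq_add_of_le (show T ≤ t by omega)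
    apply List.eq_nil_of_length_eq_zero
    rw [hlen]
    omega
  have hloc : ∀ t ≥ T, (exec I b t).loc = (exec I a T).loc := by
    intro t ht
    induction t, ht using Nat.le_induction with
    | base => rw [heq]
    | succ t ht ih =>
      rw [exec, ← ih]
      rcases hcase t ht with e | e <;> rw [e]
      · rw [GlobalState.next_idle]
      · rw [GlobalState.next_prop]
  refine ⟨b, T + ((exec I a T).tso.buf i).length, ⟨?_, ?_⟩, by omega, hb1, hcase, ?_,
    hnil _ le_rfl, hloc _ (by omega), ?_⟩
  · intro t
    rcases lt_or_ge t T with ht | ht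
    · rw [hb1 t ht, exec_congr hb1 ht.le]
      exact h.ok t
    · rw [hb2 t ht]
      split_ifs with hc
      · exact hc
      · trivial
  · have key : ∀ t j v, b t = .invoke j (.write v) → a t = .invoke j (.write v) := by
      intro t j v e
      rcases lt_or_ge t T with ht | ht
      · rwa [← hb1 t ht]
      · rcases hcase t ht with e' | e' <;> simp [e'] at e
    exact fun t t' j j' v h1 h2 => h.once _ _ _ _ _ (key _ _ _ h1) (key _ _ _ h2)
  · intro t ht
    rw [hb2 t (by omega), if_neg (by simpa using hnil t ht)]
  · intro j hj
    rw [exec_buf_of_by hby hj (by omega), heq]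

end Executions

end TSO

/-! ### A read that follows a completed write. -/

namespace TSO

theorem Legal.append_right {V : Type*} {l₁ l₂ : List (RegOp V × RegResp V)} {v : V}
    (h : Legal v (l₁ ++ l₂)) : ∃ w, Legal w l₂ := by
  induction l₁ generalizing v with
  | nil => exact ⟨v, h⟩
  | cons p l ih =>
    obtain ⟨_ | w, _ | u⟩ := p
    · exact absurd h (by simp [Legal])
    · exact ih h.2
    · exact ih (v := w) h
    · exact absurd h (by simp [Legal])

theorem Legal.read_after_write {V : Type*} {l : List (RegOp V × RegResp V)} {v w : V}
    {r resp : RegResp V} (h : Legal w ((.write v, r) :: (.read, resp) :: l)) : resp = .val v := by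
  rcases r with _ | r
  · rcases resp with _ | u
    · exact absurd h (by simp [Legal])
    · rw [h.1]
  · exact absurd h (by simp [Legal])

section Writes

variable {n : ℕ} {Var Val V A : Type*} [DecidableEq Var] {I : Implementation n Var Val V A}

/-- In a linearizable execution, a read by `q` that starts after a write by `p` has returned
obtains the written value, if all operations but this read are by `p` and start no later than the
write. -/
theorem IsExec.read_eq {c : ℕ → Step n Var Val V A} (h : IsExec I c) {v₀ v : V}
    (hlin : I.Linearizable v₀) {p q : Fin n} (hpq : p ≠ q) {T S t u : ℕ} {r resp : RegResp V}
    (hW : c T = .invoke p (.write v)) (hR : c S = .invoke q .read)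
    (hWr : ReturnsAt c p T t r) (htS : t + 1 < S) (hRr : ReturnsAt c q S u resp)
    (hinv : ∀ s j o, c s = .invoke j o → (j = p ∧ s ≤ T) ∨ (j = q ∧ s = S)) :
    resp = .val v := by
  obtain ⟨-, L, hnd, hL, hcompl, hpw, hleg⟩ := hlin h.toRun (u + 1)
  have hSu := hRr.1
  have hWe := h.toRun_endsAt (X := (p, T)).2 ⟨⟨_, hW⟩, t, rfl, hWr⟩
  have hRe := h.toRun_endsAt (X := (q, S)).2 ⟨⟨_, hR⟩, u, rfl, hRr⟩
  obtain ⟨o, hX⟩ := hcompl _ _ _ (by omega) hWe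
  obtain ⟨o', hY⟩ := hcompl _ _ _ le_rfl hRe
  have ho : o = .write v := by
    have := h.toRun_invoked.1 (hL _ hX).2
    simp only [hW] at this
    cases this
    rfl
  have ho' : o' = .read := by
    have := h.toRun_invoked.1 (hL _ hY).2
    simp only [hR] at this
    cases this
    rfl
  subst ho ho'
  obtain ⟨l₁, l₂, rfl⟩ := List.append_of_mem hX
  have hprec : h.toRun.Precedes (p, T) (q, S) := .inl ⟨_, _, hWe, htS⟩
  have hYl : ((q, S), RegOp.read, resp) ∈ l₂ := by
    rcases List.mem_append.1 hY with hY | hY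
    · exact absurd hprec ((List.pairwise_append.1 hpw).2.2 _ hY _ List.mem_cons_self)
    · rcases List.mem_cons.1 hY with hY | hY
      · simp only [Prod.mk.injEq] at hY
        exact absurd hY.1.1.symm hpq
      · exact hY
  -- Only the read can follow the write in the linearization: earlier operations of `p` come before
  -- it in program order, and the write itself does not occur twice. Hence the read comes
  -- immediately after the write.
  have hl₂ : ∀ z ∈ l₂, z.1 = (q, S) := by
    rintro ⟨⟨j, s⟩, o, r'⟩ hz
    rcases hinv _ _ _ (h.toRun_invoked.1 (hL ((j, s), o, r') (by simp [hz])).2) with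
      ⟨hj, hs⟩ | ⟨hj, hs⟩
    · simp only at hj hs
      subst hj
      rcases hs.lt_or_eq with hs | rfl
      · refine absurd ?_ ((List.pairwise_cons.1 (List.pairwise_append.1 hpw).2.1).1 _ hz)
        exact .inr ⟨rfl, hs⟩
      · rw [List.map_append, List.nodup_append] at hnd
        have := hnd.2.1
        rw [List.map_cons, List.nodup_cons] at this
        exact absurd (List.mem_map_of_mem (f := Prod.fst) hz) this.1
    · simp_all
  rcases l₂ with _ | ⟨z, l₃⟩
  · simp at hYl
  · have hz : z = ((q, S), RegOp.read, resp) := by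
      rcases List.mem_cons.1 hYl with e | hm
      · exact e.symm
      · rw [List.map_append, List.nodup_append] at hnd
        have := hnd.2.1
        rw [List.map_cons, List.nodup_cons, List.map_cons, List.nodup_cons, hl₂ z (by simp)] at this
        exact absurd (List.mem_map_of_mem (f := Prod.fst) hm) this.2.1
    subst hz
    rw [List.map_append] at hleg
    obtain ⟨w, hw⟩ := hleg.append_right
    exact Legal.read_after_write hw

/-- A write of `v` by `p` that is executed alone performs a fence or an RMW, provided that a read
by `q`, executed alone in place of the write, would not return `v`. -/
theorem exists_sync {v₀ v : V} (hlin : I.Linearizable v₀) {p q : Fin n} (hpq : p ≠ q)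
    {a b : ℕ → Step n Var Val V A} (ha : IsExec I a) (hb : IsExec I b) {T t u : ℕ}
    {r resp : RegResp V} (hab : ∀ s < T, a s = b s)
    (hinv : ∀ s < T, ∀ j o, a s = .invoke j o → j = p)
    (hbuf : ∀ j, (exec I a T).tso.buf j = [])
    (haT : a T = .invoke p (.write v)) (haby : ∀ s ≥ T, (a s).By p)
    (hainv : ∀ s > T, ∀ j o, a s ≠ .invoke j o) (har : ReturnsAt a p T t r)
    (hbT : b T = .invoke q .read) (hbby : ∀ s ≥ T, (b s).By q)
    (hbinv : ∀ s > T, ∀ j o, b s ≠ .invoke j o) (hbr : ReturnsAt b q T u resp)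
    (hne : resp ≠ .val v) : ∃ s, T < s ∧ s ≤ t ∧ ∃ α, a s = .proc p α ∧ α.IsSync := by
  by_contra! hns
  have hsync : ∀ s ≥ T, s ≤ t → ∀ α, a s = .proc p α → ¬ α.IsSync := by
    intro s hs hst α hα
    rcases hs.lt_or_eq with hs | rfl
    · exact hns s hs hst α hα
    · simp [haT] at hα
  have hTt := har.1
  -- The spliced execution: the common prefix, the write of `p` without propagation, then the read
  -- of `q` taken from `b`. The write ends at time `t + 1`, and precedence demands that the read
  -- start strictly later, hence the idle round.
  let c : ℕ → Step n Var Val V A := fun s =>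
    if s < T then a s else if s ≤ t then (a s).delay else if s = t + 1 then .idle
    else b (T + (s - (t + 2)))
  have hc1 : ∀ s < T, c s = a s := fun s hs => by simp [c, hs]
  have hc2 : ∀ s ≥ T, s ≤ t → c s = (a s).delay := fun s hs hst => by
    simp [c, hst, Nat.not_lt.2 hs]
  have hc3 : c (t + 1) = .idle := by
    simp only [c]
    rw [if_neg (by omega), if_neg (by omega), if_pos trivial]
  have hc4 : ∀ k, c (t + 2 + k) = b (T + k) := fun k => by
    simp only [c]
    rw [if_neg (by omega), if_neg (by omega), if_neg (by omega)]
    congr 2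
    omega
  have heq : exec I c T = exec I a T := exec_congr hc1 le_rfl
  have heqb : exec I a T = exec I b T := exec_congr hab le_rfl
  -- To `p` the delayed write looks like the original one, while memory and everything local to `q`
  -- stay as they were at time `T`.
  have hD : ∀ s ≥ T, s ≤ t + 1 → (exec I a s).Delayed p (exec I c s) ∧
      (exec I c s).tso.mem = (exec I a T).tso.mem ∧
      (exec I c s).tso.buf q = [] ∧ (exec I c s).loc q = (exec I a T).loc q := by
    intro s hs
    induction s, hs using Nat.le_induction with
    | base => exact fun _ => ⟨by rw [heq]; exact ⟨rfl, fun _ => rfl⟩, by rw [heq],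
        by rw [heq, hbuf], by rw [heq]⟩
    | succ s hs ih =>
      intro hst
      obtain ⟨h1, h2, h3, h4⟩ := ih (by omega)
      have hby := haby s hs
      have hs' := hsync s hs (by omega)
      have hp := fun α e => hs' α e
      rw [exec, exec, hc2 s hs (by omega)]
      refine ⟨h1.next hby hp, ?_, ?_, ?_⟩
      · rw [GlobalState.next_delay_mem _ hby hp, h2]
      · rw [GlobalState.next_buf_of_by _ hby.delay hpq.symm, h3]
      · rw [GlobalState.next_loc_of_by _ hby.delay hpq.symm, h4]
  -- Only the buffer and local state of `p` have changed since time `T`, and `q` sees neither.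
  have hA : ∀ k, (exec I b (T + k)).AgreeFor q (exec I c (t + 2 + k)) := by
    intro k
    induction k with
    | zero =>
      obtain ⟨-, h2, h3, h4⟩ := hD (t + 1) (by omega) le_rfl
      rw [add_zero, add_zero, exec, hc3, GlobalState.next_idle, ← heqb]
      exact ⟨h2.symm, by rw [hbuf, h3], h4.symm⟩
    | succ k ih =>
      rw [← add_assoc, ← add_assoc, exec, exec, hc4]
      exact ih.next (hbby _ (by omega))
  have hcinv : ∀ s j o, c s = .invoke j o →
      (s ≤ T ∧ a s = .invoke j o) ∨ (s = t + 2 ∧ j = q ∧ o = .read) := by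
    intro s j o hs
    rcases lt_or_ge s T with h | h
    · rw [hc1 s h] at hs
      exact .inl ⟨h.le, hs⟩
    rcases le_or_gt s t with h' | h'
    · rw [hc2 s h h'] at hs
      have : a s = .invoke j o := by
        revert hs
        cases a s <;> simp [Step.delay]
      rcases h.lt_or_eq with h | rfl
      · exact absurd this (hainv s h _ _)
      · exact .inl ⟨le_rfl, this⟩
    rcases Nat.eq_or_lt_of_le h' with rfl | h'
    · simp only [Nat.succ_eq_add_one] at hs
      rw [hc3] at hs
      cases hs
    · obtain ⟨k, rfl⟩ := Nat.exists_eq_add_of_le (show t + 2 ≤ s by omega)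
      rw [hc4] at hs
      rcases k.eq_zero_or_pos with rfl | hk
      · rw [add_zero, hbT] at hs
        cases hs
        exact .inr ⟨rfl, rfl, rfl⟩
      · exact absurd hs (hbinv _ (by omega) _ _)
  have hc : IsExec I c := by
    constructor
    · intro s
      rcases lt_or_ge s T with h | h
      · rw [hc1 s h, exec_congr hc1 h.le]
        exact ha.ok s
      rcases le_or_gt s t with h' | h'
      · rw [hc2 s h h']
        exact (hD s h (by omega)).1.ok (hsync s h h') (haby s h) (ha.ok s)
      rcases Nat.eq_or_lt_of_le h' with rfl | h'
      · simp only [Nat.succ_eq_add_one]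
        rw [hc3]
        trivial
      · obtain ⟨k, rfl⟩ := Nat.exists_eq_add_of_le (show t + 2 ≤ s by omega)
        rw [hc4]
        exact (hA k).ok (hbby _ (by omega)) (hb.ok _)
    · intro s s' j j' w h1 h2
      rcases hcinv _ _ _ h1 with ⟨-, h1⟩ | ⟨-, -, h1⟩
      · rcases hcinv _ _ _ h2 with ⟨-, h2⟩ | ⟨-, -, h2⟩
        · exact ha.once _ _ _ _ _ h1 h2
        · cases h2
      · cases h1
  refine hne (hc.read_eq hlin hpq (T := T) (S := t + 2) (t := t) (u := t + 2 + (u - T)) (r := r)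
    ?_ ?_ ?_ (by omega) ?_ ?_)
  · rw [hc2 T le_rfl hTt.le, haT]
    rfl
  · rw [← hbT]
    exact hc4 0
  · refine ⟨hTt, ?_, fun s h1 h2 r' => ?_⟩
    · rw [hc2 t hTt.le le_rfl, har.2.1]
      rfl
    · rw [hc2 s h1.le h2.le]
      have := har.2.2 s h1 h2 r'
      revert this
      cases a s <;> simp [Step.delay]
  · have hTu := hbr.1
    refine ⟨by omega, ?_, fun s h1 h2 r' => ?_⟩
    · rw [hc4, show T + (u - T) = u by omega]
      exact hbr.2.1
    · obtain ⟨k, rfl⟩ := Nat.exists_eq_add_of_le h1.le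
      rw [hc4]
      exact hbr.2.2 _ (by omega) (by omega) r'
  · intro s j o hs
    rcases hcinv _ _ _ hs with ⟨h1, h2⟩ | ⟨h1, h2, -⟩
    · refine .inl ⟨?_, h1⟩
      rcases h1.lt_or_eq with h1 | rfl
      · exact hinv s h1 j o h2
      · rw [haT] at h2
        cases h2
        rfl
    · exact .inr ⟨h2, h1⟩

/-! ### Iterating synchronizing writes. -/

/-- The operation of `p` that starts at time `s` returns before time `T`, and performs a fence or
an RMW before it returns. -/
def SyncsBefore (a : ℕ → Step n Var Val V A) (p : Fin n) (T s : ℕ) : Prop :=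
  ∃ t < T, ∃ resp, ReturnsAt a p s t resp ∧
    ∃ k, s < k ∧ k ≤ t ∧ ∃ α, a k = .proc p α ∧ α.IsSync

omit [DecidableEq Var] in
theorem SyncsBefore.congr {a b : ℕ → Step n Var Val V A} {p : Fin n} {T U s : ℕ}
    (h : SyncsBefore a p T s) (hab : ∀ t < T, b t = a t) (hTU : T ≤ U) : SyncsBefore b p U s := by
  obtain ⟨t, ht, resp, ⟨h1, h2, h3⟩, k, hk, hkt, α, hα⟩ := h
  refine ⟨t, by omega, resp, ⟨h1, by rw [hab t ht, h2], fun t' h4 h5 => ?_⟩, k, hk, hkt, α, ?_, hα.2⟩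
  · rw [hab t' (by omega)]
    exact h3 t' h4 h5
  · rw [hab k (by omega), hα.1]

/-- An execution, idle from time `T` on, in which `p` has performed exactly `m` operations, all of
them synchronizing writes, and at whose end all buffers are empty and no operation is pending. -/
structure SyncWrites (I : Implementation n Var Val V A) (p : Fin n) (m : ℕ)
    (a : ℕ → Step n Var Val V A) (T : ℕ) : Prop where
  isExec : IsExec I a
  idle : ∀ t ≥ T, a t = .idle
  buf : ∀ j, (exec I a T).tso.buf j = []
  pend : ∀ j, pendingOp ((exec I a T).loc j) = none
  inv : ∀ t j o, a t = .invoke j o → j = p ∧ SyncsBefore a p T t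
  card : {t | ∃ v, a t = .invoke p (.write v)}.encard = m

/-- A hypothetical solo read of `q` fixes one response to avoid; a fresh value other than it is then
written by `p`, and `exists_sync` applies. -/
theorem SyncWrites.succ [Infinite V] {v₀ : V} (hlin : I.Linearizable v₀)
    (hof : I.ObstructionFree) {p q : Fin n} (hpq : p ≠ q) {m : ℕ} {a : ℕ → Step n Var Val V A}
    {T : ℕ} (h : SyncWrites I p m a T) : ∃ b U, SyncWrites I p (m + 1) b U := by
  obtain ⟨b, hb, hba, hbT, hbby, hbinv, u, resp, hbr⟩ :=
    exists_solo hof h.isExec q .read h.buf (h.pend q) (by simp)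
  -- The values to avoid: each round before `T` invokes at most one write, and the response of the
  -- read is at most one value.
  have hfin : {v | (∃ t < T, ∃ j, a t = .invoke j (.write v)) ∨ resp = .val v}.Finite := by
    have h1 : {v | ∃ t < T, ∃ j, a t = .invoke j (.write v)}.Finite := by
      have : {v | ∃ t < T, ∃ j, a t = .invoke j (.write v)} ⊆
          ⋃ t ∈ Set.Iio T, {v | ∃ j, a t = .invoke j (.write v)} := by
        rintro v ⟨t, ht, j, e⟩
        simp only [Set.mem_iUnion]
        exact ⟨t, ht, j, e⟩
      refine Set.Finite.subset ((Set.finite_Iio T).biUnion fun t _ => ?_) this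
      refine Set.Subsingleton.finite ?_
      rintro v ⟨j, e⟩ w ⟨k, e'⟩
      rw [e] at e'
      cases e'
      rfl
    have h2 : {v | resp = .val v}.Finite := by
      refine Set.Subsingleton.finite ?_
      rintro v e w e'
      simp only [Set.mem_ofPred_eq] at e e'
      rw [e] at e'
      cases e'
      rfl
    exact h1.union h2
  obtain ⟨v, hv⟩ := hfin.exists_notMem
  simp only [Set.mem_ofPred_eq, not_or] at hv
  obtain ⟨c, hc, hca, hcT, hcby, hcinv, t, r, hcr⟩ :=
    exists_solo hof h.isExec p (.write v) h.buf (h.pend p) (by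
      rintro _ ⟨⟩ s hs j e
      exact hv.1 ⟨s, hs, j, e⟩)
  have hcaT : exec I c T = exec I a T := exec_congr hca le_rfl
  obtain ⟨k, hk, hkt, α, hα⟩ := exists_sync hlin hpq hc hb
    (fun s hs => by rw [hca s hs, hba s hs])
    (fun s hs j o e => (h.inv s j o (by rw [← hca s hs, e])).1)
    (by rw [hcaT]; exact h.buf) hcT hcby hcinv hcr hbT hbby hbinv hbr hv.2
  have hTt := hcr.1
  -- The execution is cut right after the return of the write, so `p` has no pending operation;
  -- propagating its remaining stores then makes all buffers empty again.
  obtain ⟨d, U, hd, hd3, hd1, hd2, hd4, hd5, hd6, hd7⟩ := exists_flush hc (T := t + 1) p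
  have hdT : d T = .invoke p (.write v) := by rw [hd1 T (by omega), hcT]
  have hda : ∀ s < T, d s = a s := fun s hs => by rw [hd1 s (by omega), hca s hs]
  have hdinv : ∀ s j o, d s = .invoke j o →
      (s < T ∧ a s = .invoke j o) ∨ (s = T ∧ j = p ∧ o = .write v) := by
    intro s j o e
    rcases lt_trichotomy s T with hs | rfl | hs
    · exact .inl ⟨hs, by rw [← hda s hs, e]⟩
    · rw [hdT] at e
      cases e
      exact .inr ⟨rfl, rfl, rfl⟩
    · rcases lt_or_ge s (t + 1) with hs' | hs'
      · rw [hd1 s hs'] at e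
        exact absurd e (hcinv s hs _ _)
      · rcases hd2 s hs' with e' | e' <;> simp [e'] at e
  refine ⟨d, U, hd, hd4, ?_, ?_, ?_, ?_⟩
  · intro j
    by_cases hj : j = p
    · rw [hj, hd5]
    · rw [hd7 j hj, exec_buf_of_by hcby hj (by omega), hcaT, h.buf]
  · intro j
    rw [hd6]
    by_cases hj : j = p
    · subst hj
      rw [exec, hcr.2.1, GlobalState.next_proc]
      simp [MemState.record, pendingOp]
    · rw [exec_loc_of_by hcby hj (by omega), hcaT, h.pend]
  · intro s j o e
    rcases hdinv s j o e with ⟨hs, e⟩ | ⟨rfl, rfl, rfl⟩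
    · exact ⟨(h.inv s j o e).1, (h.inv s j o e).2.congr hda (by omega)⟩
    · have : SyncsBefore c j (t + 1) s := ⟨t, by omega, r, hcr, k, hk, hkt, α, hα⟩
      exact ⟨rfl, this.congr hd1 hd3⟩
  · have : {s | ∃ w, d s = .invoke p (.write w)} =
        insert T {s | ∃ w, a s = .invoke p (.write w)} := by
      ext s
      constructor
      · rintro ⟨w, e⟩
        rcases hdinv _ _ _ e with ⟨-, e⟩ | ⟨rfl, -⟩
        · exact .inr ⟨w, e⟩
        · exact .inl rfl
      · rintro (rfl | ⟨w, e⟩)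
        · exact ⟨v, hdT⟩
        · have hs : s < T := by
            by_contra hc
            rw [h.idle s (by omega)] at e
            cases e
          exact ⟨w, by rw [hda s hs, e]⟩
    rw [this, Set.encard_insert_of_notMem, h.card]
    · simp
    · rintro ⟨w, e⟩
      rw [h.idle T le_rfl] at e
      cases e

theorem exists_syncWrites [Infinite V] {v₀ : V} (hlin : I.Linearizable v₀)
    (hof : I.ObstructionFree) {p q : Fin n} (hpq : p ≠ q) (m : ℕ) :
    ∃ a T, SyncWrites I p m a T := by
  induction m with
  | zero =>
    refine ⟨fun _ => .idle, 0, ⟨fun _ => trivial, ?_⟩, ?_, ?_, ?_, ?_, ?_⟩ <;>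
      simp [exec, Implementation.init, pendingOp]
  | succ m ih =>
    obtain ⟨a, T, h⟩ := ih
    exact h.succ hlin hof hpq

/-- Every execution that has become idle can be continued fairly without further invocations. -/
theorem exists_fair {a : ℕ → Step n Var Val V A} (h : IsExec I a) (T : ℕ) :
    ∃ b, ∃ hb : IsExec I b, hb.toRun.Fair ∧ (∀ t < T, b t = a t) ∧
      ∀ t ≥ T, ∀ j o, b t ≠ .invoke j o := by
  obtain ⟨b, hb1, hb2⟩ := exists_exec_policy I a T (fun t g => schedStep I Set.univ g (turn n t))
  have hinv : ∀ t ≥ T, ∀ j o, b t ≠ .invoke j o := by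
    intro t ht j o
    rw [hb2 t ht]
    rcases schedStep_cases (I := I) Set.univ (exec I b t) (turn n t) with
      e | ⟨_, _, _, e⟩ | ⟨_, _, e⟩ <;> rw [e] <;> simp
  have hS : Scheduled I Set.univ T b := hb2
  have hb : IsExec I b := by
    constructor
    · intro t
      rcases lt_or_ge t T with ht | ht
      · rw [hb1 t ht, exec_congr hb1 ht.le]
        exact h.ok t
      · rw [hb2 t ht]
        exact schedStep_ok _ _ _
    · have key : ∀ t j v, b t = .invoke j (.write v) → a t = .invoke j (.write v) := by
        intro t j v e
        rcases lt_or_ge t T with ht | ht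
        · rwa [← hb1 t ht]
        · exact absurd e (hinv t ht _ _)
      exact fun t t' j j' v h1 h2 => h.once _ _ _ _ _ (key _ _ _ h1) (key _ _ _ h2)
  exact ⟨b, hb, ⟨hS.propFair hb, fun i => hS.procFair hb (Set.mem_univ i)⟩, hb1, hinv⟩

end Writes

end TSO

theorem mainTheorem6 {n : ℕ} (hn : 2 ≤ n) {Var Val V A : Type*} [DecidableEq Var] [Finite Var]
    [Infinite V] (v₀ : V) (I : TSO.Implementation n Var Val V A)
    (hlin : I.Linearizable v₀) (hof : I.ObstructionFree) (m : ℕ) (hm : 0 < m) :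
    ∃ r : TSO.Run I, r.Fair ∧ {X : TSO.OpId n | r.IsWrite X}.encard = m ∧
      ∀ X : TSO.OpId n, r.IsWrite X → r.CompletesWithSync X := by
  have hpq : (⟨0, by omega⟩ : Fin n) ≠ ⟨1, by omega⟩ := by simp
  generalize (⟨0, by omega⟩ : Fin n) = p at hpq
  generalize (⟨1, by omega⟩ : Fin n) = q at hpq
  obtain ⟨a, T, ha⟩ := TSO.exists_syncWrites hlin hof hpq m
  obtain ⟨b, hb, hfair, hba, hinv⟩ := TSO.exists_fair ha.isExec T
  -- From time `T` on neither execution invokes anything: `a` is idle and the fair continuation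
  -- contains no invocations. So the number of writes carries over.
  have key : ∀ t j o, b t = .invoke j o ↔ a t = .invoke j o := by
    intro t j o
    rcases lt_or_ge t T with ht | ht
    · rw [hba t ht]
    · rw [ha.idle t ht]
      simp [hinv t ht]
  refine ⟨hb.toRun, hfair, ?_, ?_⟩
  · have : {X : TSO.OpId n | hb.toRun.IsWrite X} =
        Prod.mk p '' {t | ∃ v, a t = .invoke p (.write v)} := by
      ext ⟨j, t⟩
      simp only [TSO.Run.IsWrite, TSO.IsExec.toRun_invoked, key, Set.mem_ofPred_eq, Set.mem_image,
        Prod.mk.injEq]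
      constructor
      · rintro ⟨v, e⟩
        exact ⟨t, ⟨v, (ha.inv _ _ _ e).1 ▸ e⟩, (ha.inv _ _ _ e).1.symm, rfl⟩
      · rintro ⟨_, ⟨v, e⟩, rfl, rfl⟩
        exact ⟨v, e⟩
    rw [this, (Prod.mk_right_injective p).encard_image, ha.card]
  · rintro ⟨j, s⟩ ⟨v, e⟩
    rw [TSO.IsExec.toRun_invoked] at e
    obtain ⟨rfl, hs⟩ := ha.inv _ _ _ ((key _ _ _).1 e)
    obtain ⟨t, -, resp, hr, k, hk, hkt, α, hα, hsync⟩ := hs.congr hba le_rfl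
    refine ⟨t + 1, resp, hb.toRun_endsAt.2 ⟨⟨_, e⟩, t, rfl, hr⟩, k, hk, by omega, ?_⟩
    have hact : (hb.toRun.act k).proc j = some α := TSO.Step.toJoint_proc_eq_some.2 hα
    rcases hsync.eq_fence_or_rmw with rfl | ⟨x, v₁, v₂, rfl⟩
    · exact .inl hact
    · exact .inr ⟨x, v₁, v₂, hact⟩
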